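/- Let $Q=Q_1Q_2Q_3Q_4$ be a nondegenerate convex quadrilateral in the plane (regarded as a closed region), with vertices named anticlockwise so that $Q_1Q_3$ is a shortest diagonal. Every $x\in Q$ has a unique representation $x=\sum_i\alpha_iQ_i$ with $\alpha_i\ge 0$, $\sum_i\alpha_i=1$ and $\alpha_2=0$ or $\alpha_4=0$; for a quadrilateral $R=R_1R_2R_3R_4$ inside $Q$ put $P_R(x)=\sum_i\alpha_iR_i$. For $m\ge 2$ let $A=A_1\cup A_2\cup A_3$ be the set of the following $k=(k_1,k_2,k_3,k_4)$ with nonnegative integer entries: $k\in A_1$ if $k_1+k_2+k_3=m-1$, $k_4=0$, $k_2\ne 0$; $k\in A_2$ if $k_1+k_3+k_4=m-1$, $k_2=0$, $k_4\neq 0$; $k\in A_3$ if $k_1+k_3=m-1$, $k_2=k_4=0$. For $k\in A$ put $b=\sum_i k_iQ_i$ and let $S_m(k)=R_1R_2R_3R_4$ with $R_i=\frac1m(b+Q_i)$ for all $i$, except that $R_4=\frac1m(b+Q_1-Q_2+Q_3)$ if $k\in A_1$ and $R_2=\frac1m(b+Q_1+Q_3-Q_4)$ if $k\in A_2$. Let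 $\mathcal S_m=\{S_m(k):k\in A\}$. Let $m\ge 4$, and let $\mathcal W_1\subseteq\mathcal S_m$ be an $m\times m$ quadrilateral labyrinth set, that is: 1. (Tree property) the graph with vertex set $\mathcal W_1$, in which two distinct quadrilaterals are adjacent iff they have a common side, is a tree; 2. (Exit property) there is exactly one $(k_1,k_2,0,0)\in A$ such that $S_m(k_1,k_2,0,0)\in\mathcal W_1$ and $S_m(0,0,k_2,k_1)\in\mathcal W_1$, and exactly one $(k_1,0,0,k_4)\in A$ such that $S_m(k_1,0,0,k_4)\in\mathcal W_1$ and $S_m(0,k_1,k_4,0)\in\mathcal W_1$; 3. (Corner property) $\mathcal W_1$ contains at most one element of $\{S_m(m-1,0,0,0),S_m(0,0,m-1,0)\}$ and at most one element of $\{S_m(0,m-1,0,0),S_m(0,0,0,m-1)\}$. For $n\ge 2$ let $\mathcal W_n=\{P_V(R): V\in\mathcal W_{n-1},\ R\in\mathcal W_1\}$, where $P_V(R)$ is the quadrilateral whose vertices are the images under $P_V$ of the vertices of $R$, in the same order. Let $L_n=\bigcup_{U\in\mathcal W_n}U$ for $n\ge 1$ and $L_\infty=\bigcap_{n\ge 1}L_n$.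 Then $Q\setminus L_\infty$ is nonempty and not path connected. -/

import Mathlib

namespace QuadLabyrinth

/-- The Euclidean plane. -/
abbrev Plane := EuclideanSpace ℝ (Fin 2)

/-- A quadrilateral `R₁R₂R₃R₄`, given by its ordered vertices; `R₁, …, R₄` have indices `0, …, 3`. -/
abbrev Quad := Fin 4 → Plane

/-- The region of the plane covered by a convex quadrilateral. -/
def Quad.region (R : Quad) : Set Plane := convexHull ℝ (Set.range R)

/-- The (undirected) sides of a quadrilateral, each given by its two end points. -/
def Quad.sides (R : Quad) : Set (Sym2 Plane) := {s | ∃ i : Fin 4, s = s(R i, R (i + 1))}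

/-- `det (b - a, c - b)`: positive iff `a`, `b`, `c` make a strict left turn at `b`. -/
def turn (a b c : Plane) : ℝ :=
  (b 0 - a 0) * (c 1 - b 1) - (b 1 - a 1) * (c 0 - b 0)

/-- `Q₁Q₂Q₃Q₄` is a nondegenerate convex quadrilateral whose vertices are named anticlockwise
(a strict left turn at each of the four vertices), starting from an end point of a shortest
diagonal, so that this diagonal is `Q₁Q₃`. -/
structure IsConvexQuad (Q : Quad) : Prop where
  left_turn : ∀ i : Fin 4, 0 < turn (Q i) (Q (i + 1)) (Q (i + 2))
  shortest_diagonal : dist (Q 0) (Q 2) ≤ dist (Q 1) (Q 3)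

/-- `α` is the representation of `x` in `Q`: barycentric coordinates of `x` in one of the triangles
`Q₁Q₂Q₃` (then `α₄ = 0`) and `Q₃Q₄Q₁` (then `α₂ = 0`). For a convex quadrilateral `Q` and a point
`x` of `Q` there is exactly one. -/
structure IsRep (Q : Quad) (x : Plane) (α : Fin 4 → ℝ) : Prop where
  nonneg : ∀ i, 0 ≤ α i
  sum_eq_one : ∑ i, α i = 1
  sum_smul : ∑ i, α i • Q i = x
  triangle : α 1 = 0 ∨ α 3 = 0

/-- The representation of a point of `Q` (a meaningless value outside `Q`). -/
noncomputable def rep (Q : Quad) (x : Plane) : Fin 4 → ℝ := Classical.epsilon (IsRep Q x)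

/-- The map `P_R : Q → R`, `x ↦ ∑ αᵢ Rᵢ`, where `α` is the representation of `x` in `Q`. -/
noncomputable def P (Q R : Quad) (x : Plane) : Plane := ∑ i, rep Q x i • R i

/-- Indices of the cells inside the triangle `Q₁Q₂Q₃`. -/
def A₁ (m : ℕ) : Set (Fin 4 → ℕ) := {k | k 0 + k 1 + k 2 + 1 = m ∧ k 3 = 0 ∧ k 1 ≠ 0}

/-- Indices of the cells inside the triangle `Q₃Q₄Q₁`. -/
def A₂ (m : ℕ) : Set (Fin 4 → ℕ) := {k | k 0 + k 2 + k 3 + 1 = m ∧ k 1 = 0 ∧ k 3 ≠ 0}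

/-- Indices of the cells along the diagonal `Q₁Q₃`. -/
def A₃ (m : ℕ) : Set (Fin 4 → ℕ) := {k | k 0 + k 2 + 1 = m ∧ k 1 = 0 ∧ k 3 = 0}

/-- The index set of the subdivision of `Q` into `m * m` cells. -/
def A (m : ℕ) : Set (Fin 4 → ℕ) := A₁ m ∪ A₂ m ∪ A₃ m

/-- The cell `S_m(k₁,k₂,k₃,k₄)` of `Q`, for `k ∈ A m`. The three cases are `k ∈ A₁ m`, `k ∈ A₂ m`
and `k ∈ A₃ m`. -/
noncomputable def cell (Q : Quad) (m : ℕ) (k : Fin 4 → ℕ) : Quad :=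
  let b : Plane := ∑ i, (k i : ℝ) • Q i
  let c : ℝ := (m : ℝ)⁻¹
  if k 1 ≠ 0 then
    ![c • (b + Q 0), c • (b + Q 1), c • (b + Q 2), c • (b + Q 0 - Q 1 + Q 2)]
  else if k 3 ≠ 0 then
    ![c • (b + Q 0), c • (b + Q 0 + Q 2 - Q 3), c • (b + Q 2), c • (b + Q 3)]
  else
    ![c • (b + Q 0), c • (b + Q 1), c • (b + Q 2), c • (b + Q 3)]

/-- The set `𝒮_m` of all cells of the subdivision. -/
def cells (Q : Quad) (m : ℕ) : Set Quad := cell Q m '' A m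

/-- The graph of a set of white quadrilaterals: two different ones are adjacent iff they have a
common side. -/
def whiteGraph (W : Set Quad) : SimpleGraph W where
  Adj U V := U ≠ V ∧ (U.1.sides ∩ V.1.sides).Nonempty
  symm := ⟨fun _ _ h => ⟨h.1.symm, by rw [Set.inter_comm]; exact h.2⟩⟩
  loopless := ⟨fun _ h => h.1 rfl⟩

/-- `W` is an `m × m` quadrilateral labyrinth set in `Q`. -/
structure IsLabyrinthSet (Q : Quad) (m : ℕ) (W : Set Quad) : Prop where
  four_le : 4 ≤ m
  subset_cells : W ⊆ cells Q m
  tree : (whiteGraph W).IsTree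
  /-- exactly one pair of a left exit and a right exit opposite to it -/
  exit_left_right : ∃! p : ℕ × ℕ, ![p.1, p.2, 0, 0] ∈ A m ∧
    cell Q m ![p.1, p.2, 0, 0] ∈ W ∧ cell Q m ![0, 0, p.2, p.1] ∈ W
  /-- exactly one pair of a top exit and a bottom exit opposite to it -/
  exit_top_bottom : ∃! p : ℕ × ℕ, ![p.1, 0, 0, p.2] ∈ A m ∧
    cell Q m ![p.1, 0, 0, p.2] ∈ W ∧ cell Q m ![0, p.1, p.2, 0] ∈ W
  corner₁₃ : ¬ (cell Q m ![m - 1, 0, 0, 0] ∈ W ∧ cell Q m ![0, 0, m - 1, 0] ∈ W)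
  corner₂₄ : ¬ (cell Q m ![0, m - 1, 0, 0] ∈ W ∧ cell Q m ![0, 0, 0, m - 1] ∈ W)

/-- `white Q W n` is the set `𝒲_{n+1}` of white quadrilaterals of order `n + 1`, where `W = 𝒲₁`;
the image of a quadrilateral under `P_V` is given by the images of its vertices. -/
def white (Q : Quad) (W : Set Quad) : ℕ → Set Quad
  | 0 => W
  | n + 1 => {U | ∃ V ∈ white Q W n, ∃ R ∈ W, U = fun i => P Q V (R i)}

/-- `level Q W n` is the union `L_{n+1}` of the white quadrilaterals of order `n + 1`. -/
def level (Q : Quad) (W : Set Quad) (n : ℕ) : Set Plane := ⋃ U ∈ white Q W n, U.region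

/-- The limit set `L_∞`, the intersection of all `L_n`, `n ≥ 1`. -/
def fractal (Q : Quad) (W : Set Quad) : Set Plane := ⋂ n, level Q W n

end QuadLabyrinth

/-!
The chart that is affine on the two triangles `Q₁Q₂Q₃` and `Q₃Q₄Q₁` turns the subdivision of `Q`
into that of the unit square into `m × m` squares, and white quadrilaterals into white squares. By
the connectivity of `𝒲₁` and the exits, the white squares of every order are connected and reach
from the bottom to the top side and from the left to the right side. For a walk through white
squares from bottom to top, the number of its upward minus that of its downward steps to the left of
a black square is the same for black squares that touch each other; it is `0` in the first column
and `1` in the last one. So a continuum that joins two opposite sides meets the white region of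
every order, and by compactness it meets the limit set. By the corner property two consecutive
vertices of `Q` are outside the limit set; they lie on opposite sides, hence no path in the
complement of the limit set joins them.
-/

namespace QuadLabyrinth

/-! ### Crossing numbers of walks in the grid -/

/-- The graph of the unit squares of the integer grid, each named by its lower left corner; squares
are adjacent iff they have a common side. -/
def gridGraph : SimpleGraph (ℕ × ℕ) := (SimpleGraph.hasse ℕ).boxProd (SimpleGraph.hasse ℕ)

lemma gridGraph_adj {p q : ℕ × ℕ} : gridGraph.Adj p q ↔
    (p.1 + 1 = q.1 ∨ q.1 + 1 = p.1) ∧ p.2 = q.2 ∨ (p.2 + 1 = q.2 ∨ q.2 + 1 = p.2) ∧ p.1 = q.1 := by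
  simp only [gridGraph, SimpleGraph.boxProd_adj, SimpleGraph.hasse_adj, Order.covBy_iff_add_one_eq]

/-- `F x y` is the signed number of steps from row `y` up to row `y + 1` that a walk in `S` from
`p` to `q` makes in the columns to the left of `x`. The fields are the properties of these numbers
that do not depend on the walk. -/
structure IsCrossingNumber (S : Set (ℕ × ℕ)) (p q : ℕ × ℕ) (F : ℕ → ℕ → ℤ) : Prop where
  zero : ∀ y, F 0 y = 0
  right : ∀ x y, (x, y) ∉ S → F (x + 1) y = F x y
  up : ∀ x y z, (z, y + 1) ∉ S → x = z ∨ x = z + 1 →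
    F x (y + 1) - F x y = (if p.2 = y + 1 ∧ p.1 < x then 1 else 0) -
      (if q.2 = y + 1 ∧ q.1 < x then 1 else 0)
  total : ∀ N y, (∀ r ∈ S, r.1 < N) →
    F N y = (if y < q.2 then 1 else 0) - (if y < p.2 then 1 else 0)

/-- The crossing number of a single step from `p` to `q`. -/
def stepCrossing (p q : ℕ × ℕ) (x y : ℕ) : ℤ :=
  if p.1 < x ∧ p.1 = q.1 ∧ p.2 = y ∧ q.2 = y + 1 then 1
  else if p.1 < x ∧ p.1 = q.1 ∧ p.2 = y + 1 ∧ q.2 = y then -1 else 0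

lemma isCrossingNumber_stepCrossing {S : Set (ℕ × ℕ)} {p q : ℕ × ℕ} (hp : p ∈ S) (hq : q ∈ S)
    (h : gridGraph.Adj p q) : IsCrossingNumber S p q (stepCrossing p q) := by
  have ne_of_notMem : ∀ {x y}, (x, y) ∉ S →
      ¬ (p.1 = x ∧ p.2 = y) ∧ ¬ (q.1 = x ∧ q.2 = y) := fun hxy =>
    ⟨fun h => hxy (by rwa [← h.1, ← h.2]), fun h => hxy (by rwa [← h.1, ← h.2])⟩
  refine ⟨fun y => by simp [stepCrossing], fun x y hxy => ?_, fun x y z hz hxz => ?_,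
    fun N y hN => ?_⟩
  · have := ne_of_notMem hxy
    simp only [stepCrossing]
    split_ifs <;> omega
  · have := ne_of_notMem hz
    clear hp hq hz ne_of_notMem
    obtain ⟨a, b⟩ := p
    obtain ⟨c, d⟩ := q
    simp only [gridGraph_adj, stepCrossing] at h this ⊢
    obtain ⟨rfl | rfl, rfl⟩ | ⟨rfl | rfl, rfl⟩ := h <;> split_ifs <;> omega
  · have := hN p hp
    clear hp hq hN ne_of_notMem
    obtain ⟨a, b⟩ := p
    obtain ⟨c, d⟩ := q
    simp only [gridGraph_adj, stepCrossing] at h this ⊢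
    obtain ⟨rfl | rfl, rfl⟩ | ⟨rfl | rfl, rfl⟩ := h <;> split_ifs <;> omega

lemma IsCrossingNumber.add {S : Set (ℕ × ℕ)} {p q r : ℕ × ℕ} {F G : ℕ → ℕ → ℤ}
    (hF : IsCrossingNumber S p q F) (hG : IsCrossingNumber S q r G) :
    IsCrossingNumber S p r (fun x y => F x y + G x y) where
  zero y := by simp [hF.zero, hG.zero]
  right x y h := by rw [hF.right x y h, hG.right x y h]
  up x y z h hz := by linarith [hF.up x y z h hz, hG.up x y z h hz]
  total N y h := by linarith [hF.total N y h, hG.total N y h]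

lemma exists_isCrossingNumber {S : Set (ℕ × ℕ)} {p q : S}
    (h : (gridGraph.induce S).Reachable p q) : ∃ F, IsCrossingNumber S p q F := by
  obtain ⟨w⟩ := h
  induction w with
  | nil => exact ⟨fun _ _ => 0, by simp, by simp, by simp, by simp⟩
  | cons hadj _ ih =>
    obtain ⟨F, hF⟩ := ih
    exact ⟨_, (isCrossingNumber_stepCrossing (Subtype.prop _) (Subtype.prop _) hadj).add hF⟩

section

variable {S : Set (ℕ × ℕ)} {p q : ℕ × ℕ} {F : ℕ → ℕ → ℤ} {N x y x' y' : ℕ}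

lemma IsCrossingNumber.eq_of_same_row (hF : IsCrossingNumber S p q F) (h : (x, y) ∉ S)
    (h' : (x', y) ∉ S) (hx : x ≤ x' + 1) (hx' : x' ≤ x + 1) : F x y = F x' y := by
  obtain rfl | rfl | rfl : x = x' ∨ x' = x + 1 ∨ x = x' + 1 := by omega
  · rfl
  · exact (hF.right _ _ h).symm
  · exact hF.right _ _ h'

lemma IsCrossingNumber.eq_of_next_row (hF : IsCrossingNumber S p q F) (hp : p.2 ≠ y + 1)
    (hq : q.2 ≠ y + 1) (h : (x, y) ∉ S) (h' : (x', y + 1) ∉ S) (hx : x ≤ x' + 1)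
    (hx' : x' ≤ x + 1) : F x y = F x' (y + 1) := by
  have col : ∀ {x}, x = x' ∨ x = x' + 1 → F x y = F x (y + 1) := fun hx => by
    have := hF.up _ _ _ h' hx
    simp only [hp, hq, false_and, if_false] at this
    omega
  obtain rfl | rfl | rfl : x = x' ∨ x' = x + 1 ∨ x = x' + 1 := by omega
  · exact col (.inl rfl)
  · rw [← col (.inl rfl), hF.right _ _ h]
  · rw [col (.inr rfl), hF.right _ _ h']

lemma IsCrossingNumber.eq_of_touching (hF : IsCrossingNumber S p q F) (hp : p.2 = 0)
    (hq : N ≤ q.2) (h : (x, y) ∉ S) (h' : (x', y') ∉ S) (hy : y < N) (hy' : y' < N)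
    (hx : x ≤ x' + 1) (hx' : x' ≤ x + 1) (hyy : y ≤ y' + 1) (hyy' : y' ≤ y + 1) :
    F x y = F x' y' := by
  obtain rfl | rfl | rfl : y = y' ∨ y' = y + 1 ∨ y = y' + 1 := by omega
  · exact hF.eq_of_same_row h h' hx hx'
  · exact hF.eq_of_next_row (by omega) (by omega) h h' hx hx'
  · exact (hF.eq_of_next_row (by omega) (by omega) h' h hx' hx).symm

end

/-- `S` is a set of squares of the `m × m` grid that is connected through common sides and contains
two opposite squares of the bottom and top rows and two of the left and right columns. -/
structure IsGridLabyrinth (m : ℕ) (S : Set (ℕ × ℕ)) : Prop where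
  lt : ∀ p ∈ S, p.1 < m ∧ p.2 < m
  preconnected : (gridGraph.induce S).Preconnected
  exit_bottom_top : ∃ c, (c, 0) ∈ S ∧ (c, m - 1) ∈ S
  exit_left_right : ∃ r, (0, r) ∈ S ∧ (m - 1, r) ∈ S

lemma IsGridLabyrinth.finite {m : ℕ} {S : Set (ℕ × ℕ)} (h : IsGridLabyrinth m S) : S.Finite :=
  ((Set.finite_lt_nat m).prod (Set.finite_lt_nat m)).subset fun p hp => h.lt p hp

lemma IsGridLabyrinth.pos {m : ℕ} {S : Set (ℕ × ℕ)} (h : IsGridLabyrinth m S) : 0 < m := by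
  obtain ⟨c, hc, -⟩ := h.exit_bottom_top
  exact (h.lt _ hc).2

/-- The label of `p` is the number of upward minus that of downward steps that a walk in `T` from
the bottom to the top row makes to the left of `p`. -/
lemma IsGridLabyrinth.exists_separating_labelling {N : ℕ} {T : Set (ℕ × ℕ)}
    (hT : IsGridLabyrinth N T) :
    ∃ F : ℕ × ℕ → ℤ, (∀ p, p.1 = 0 → F p = 0) ∧
      (∀ p, p ∉ T → p.1 + 1 = N → p.2 < N → F p = 1) ∧
      ∀ p q, p ∉ T → q ∉ T → p.2 < N → q.2 < N → p ≤ q + 1 → q ≤ p + 1 → F p = F q := by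
  obtain ⟨c, hbot, htop⟩ := hT.exit_bottom_top
  obtain ⟨hcN, -⟩ := hT.lt _ hbot
  have hN := hT.pos
  -- The walk is prolonged by one square above the grid, so that it ends in no row of the grid.
  let S := insert (c, N) T
  have hTS : T ⊆ S := Set.subset_insert _ _
  have hreach : (gridGraph.induce S).Reachable ⟨(c, 0), hTS hbot⟩ ⟨(c, N), Set.mem_insert _ _⟩ := by
    refine ((hT.preconnected ⟨_, hbot⟩ ⟨_, htop⟩).map
      (SimpleGraph.induceHomOfLE gridGraph hTS).toHom).trans (SimpleGraph.Adj.reachable ?_)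
    change gridGraph.Adj (c, N - 1) (c, N)
    exact gridGraph_adj.2 (.inr ⟨.inl (Nat.sub_add_cancel hN), rfl⟩)
  obtain ⟨F, hF⟩ := exists_isCrossingNumber hreach
  have hS : ∀ {x y}, y < N → (x, y) ∉ T → (x, y) ∉ S := by
    rintro x y hy hxy (h | h)
    · exact hy.ne (Prod.ext_iff.1 h).2
    · exact hxy h
  have hSN : ∀ r ∈ S, r.1 < N := by
    rintro r (rfl | hr)
    exacts [hcN, (hT.lt r hr).1]
  refine ⟨fun p => F p.1 p.2, fun p hp => by simp only [hp, hF.zero], fun p h h1 h2 => ?_,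
    fun p q hp hq hpN hqN hpq hqp => ?_⟩
  · change F p.1 p.2 = 1
    rw [← hF.right _ _ (hS h2 h), h1, hF.total N p.2 hSN]
    simp [h2]
  · exact hF.eq_of_touching (N := N) rfl le_rfl (hS hpN hp) (hS hqN hq) hpN hqN
      hpq.1 hqp.1 hpq.2 hqp.2

/-! ### Subdivision of grid patterns -/

/-- The position of the square `r` of the `m × m` grid that subdivides the square `v`. -/
def tile (m : ℕ) (v r : ℕ × ℕ) : ℕ × ℕ := (v.1 * m + r.1, v.2 * m + r.2)

/-- Each square of `T` is replaced by a copy of the pattern `S` of squares of the `m × m` grid. -/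
def subdivide (m : ℕ) (T S : Set (ℕ × ℕ)) : Set (ℕ × ℕ) := Set.image2 (tile m) T S

/-- The pattern `S` after `n` subdivisions. -/
def gridLevel (m : ℕ) (S : Set (ℕ × ℕ)) : ℕ → Set (ℕ × ℕ)
  | 0 => S
  | n + 1 => subdivide m (gridLevel m S n) S

lemma gridGraph_adj_tile (m : ℕ) (v : ℕ × ℕ) {r s : ℕ × ℕ} (h : gridGraph.Adj r s) :
    gridGraph.Adj (tile m v r) (tile m v s) := by
  simp only [gridGraph_adj, tile] at h ⊢
  omega

/-- The embedding of the pattern `S` into the square `v` of its subdivided pattern `T`. -/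
def tileHom (m : ℕ) {T : Set (ℕ × ℕ)} (S : Set (ℕ × ℕ)) (v : T) :
    gridGraph.induce S →g gridGraph.induce (subdivide m T S) where
  toFun r := ⟨tile m v r, Set.mem_image2_of_mem v.2 r.2⟩
  map_rel' h := gridGraph_adj_tile m v h

lemma IsGridLabyrinth.exists_adj_tile {m : ℕ} {S : Set (ℕ × ℕ)} (hS : IsGridLabyrinth m S)
    {v w : ℕ × ℕ} (h : gridGraph.Adj v w) :
    ∃ a ∈ S, ∃ b ∈ S, gridGraph.Adj (tile m v a) (tile m w b) := by
  obtain ⟨c, hbot, htop⟩ := hS.exit_bottom_top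
  obtain ⟨r, hleft, hright⟩ := hS.exit_left_right
  have hm := hS.pos
  simp only [gridGraph_adj, tile] at h ⊢
  obtain ⟨h1 | h1, h2⟩ | ⟨h1 | h1, h2⟩ := h
  · exact ⟨_, hright, _, hleft, .inl ⟨.inl (by rw [← h1, add_mul]; omega), by rw [h2]⟩⟩
  · exact ⟨_, hleft, _, hright, .inl ⟨.inr (by rw [← h1, add_mul]; omega), by rw [h2]⟩⟩
  · exact ⟨_, htop, _, hbot, .inr ⟨.inl (by rw [← h1, add_mul]; omega), by rw [h2]⟩⟩
  · exact ⟨_, hbot, _, htop, .inr ⟨.inr (by rw [← h1, add_mul]; omega), by rw [h2]⟩⟩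

lemma IsGridLabyrinth.preconnected_subdivide {m : ℕ} {T S : Set (ℕ × ℕ)}
    (hS : IsGridLabyrinth m S) (hT : (gridGraph.induce T).Preconnected) :
    (gridGraph.induce (subdivide m T S)).Preconnected := by
  suffices ∀ (v w : T) (r s : S), (gridGraph.induce (subdivide m T S)).Reachable
      (tileHom m S v r) (tileHom m S w s) by
    rintro ⟨_, v, hv, r, hr, rfl⟩ ⟨_, w, hw, s, hs, rfl⟩
    exact this ⟨v, hv⟩ ⟨w, hw⟩ ⟨r, hr⟩ ⟨s, hs⟩
  intro v w r s
  obtain ⟨walk⟩ := hT v w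
  induction walk generalizing r with
  | nil => exact (hS.preconnected r s).map _
  | @cons v v' _ hadj _ ih =>
    obtain ⟨a, ha, b, hb, hab⟩ := hS.exists_adj_tile hadj
    have hstep : (gridGraph.induce (subdivide m T S)).Adj
      (tileHom m S v ⟨a, ha⟩) (tileHom m S v' ⟨b, hb⟩) := hab
    exact ((hS.preconnected r ⟨a, ha⟩).map _).trans (hstep.reachable.trans (ih ⟨b, hb⟩))

lemma tile_lt {M m : ℕ} {v r : ℕ × ℕ} (hv : v.1 < M ∧ v.2 < M) (hr : r.1 < m ∧ r.2 < m) :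
    (tile m v r).1 < M * m ∧ (tile m v r).2 < M * m := by
  have bound : ∀ {i j}, i < M → j < m → i * m + j < M * m := fun hi hj => by nlinarith
  exact ⟨bound hv.1 hr.1, bound hv.2 hr.2⟩

lemma IsGridLabyrinth.subdivide {M m : ℕ} {T S : Set (ℕ × ℕ)} (hT : IsGridLabyrinth M T)
    (hS : IsGridLabyrinth m S) : IsGridLabyrinth (M * m) (subdivide m T S) := by
  have last : (M - 1) * m + (m - 1) = M * m - 1 := by
    obtain ⟨M, rfl⟩ := Nat.exists_eq_add_of_lt hT.pos
    have := hS.pos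
    simp only [zero_add, Nat.add_sub_cancel, add_mul, one_mul]
    omega
  refine ⟨?_, hS.preconnected_subdivide hT.preconnected, ?_, ?_⟩
  · rintro _ ⟨v, hv, r, hr, rfl⟩
    exact tile_lt (hT.lt v hv) (hS.lt r hr)
  · obtain ⟨c, hbot, htop⟩ := hT.exit_bottom_top
    obtain ⟨e, hbot', htop'⟩ := hS.exit_bottom_top
    exact ⟨c * m + e, ⟨_, hbot, _, hbot', by simp [tile]⟩,
      ⟨_, htop, _, htop', by simp [tile, last]⟩⟩
  · obtain ⟨c, hleft, hright⟩ := hT.exit_left_right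
    obtain ⟨e, hleft', hright'⟩ := hS.exit_left_right
    exact ⟨c * m + e, ⟨_, hleft, _, hleft', by simp [tile]⟩,
      ⟨_, hright, _, hright', by simp [tile, last]⟩⟩

lemma isGridLabyrinth_gridLevel {m : ℕ} {S : Set (ℕ × ℕ)} (h : IsGridLabyrinth m S) (n : ℕ) :
    IsGridLabyrinth (m ^ (n + 1)) (gridLevel m S n) := by
  induction n with
  | zero => rwa [zero_add, pow_one]
  | succ n ih => exact pow_succ m (n + 1) ▸ ih.subdivide h

lemma gridGraph_adj_swap {p q : ℕ × ℕ} : gridGraph.Adj p.swap q.swap ↔ gridGraph.Adj p q := by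
  simp only [gridGraph_adj, Prod.fst_swap, Prod.snd_swap, or_comm]

lemma IsGridLabyrinth.swap {m : ℕ} {S : Set (ℕ × ℕ)} (h : IsGridLabyrinth m S) :
    IsGridLabyrinth m (Prod.swap ⁻¹' S) where
  lt p hp := (h.lt _ hp).symm
  preconnected := by
    let swapHom : gridGraph.induce S →g gridGraph.induce (Prod.swap ⁻¹' S) :=
      ⟨fun p => ⟨p.1.swap, by simp⟩, gridGraph_adj_swap.2⟩
    exact h.preconnected.map swapHom fun p => ⟨⟨p.1.swap, p.2⟩, by ext <;> rfl⟩
  exit_bottom_top := h.exit_left_right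
  exit_left_right := h.exit_bottom_top

lemma gridLevel_swap (m : ℕ) (S : Set (ℕ × ℕ)) (n : ℕ) :
    gridLevel m (Prod.swap ⁻¹' S) n = Prod.swap ⁻¹' gridLevel m S n := by
  induction n with
  | zero => rfl
  | succ n ih =>
    rw [gridLevel, gridLevel, ih, subdivide, subdivide]
    simp only [← Set.image_swap_eq_preimage_swap]
    symm
    exact Set.image_image2_distrib fun _ _ => rfl

/-! ### Continua in the unit square -/

/-- The unit square, the domain of the charts of quadrilaterals. -/
def unitSquare : Set (ℝ × ℝ) := Set.Icc 0 1 ×ˢ Set.Icc 0 1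

/-- The closed square `p` of the `N × N` grid of the unit square. -/
def gridBox (N : ℕ) (p : ℕ × ℕ) : Set (ℝ × ℝ) :=
  {s | N * s.1 ∈ Set.Icc (p.1 : ℝ) (p.1 + 1) ∧ N * s.2 ∈ Set.Icc (p.2 : ℝ) (p.2 + 1)}

/-- The closed region covered by a set of squares of the `N × N` grid of the unit square. -/
def gridRegion (N : ℕ) (T : Set (ℕ × ℕ)) : Set (ℝ × ℝ) := ⋃ p ∈ T, gridBox N p

/-- The limit set in the unit square that is generated by the pattern `S` of squares of the `m × m`
grid. -/
def gridFractal (m : ℕ) (S : Set (ℕ × ℕ)) : Set (ℝ × ℝ) :=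
  ⋂ n, gridRegion (m ^ (n + 1)) (gridLevel m S n)

lemma isClosed_gridBox (N : ℕ) (p : ℕ × ℕ) : IsClosed (gridBox N p) :=
  (isClosed_Icc.preimage (by fun_prop : Continuous fun s : ℝ × ℝ => N * s.1)).inter
    (isClosed_Icc.preimage (by fun_prop : Continuous fun s : ℝ × ℝ => N * s.2))

lemma isClosed_gridRegion (N : ℕ) {T : Set (ℕ × ℕ)} (hT : T.Finite) : IsClosed (gridRegion N T) :=
  hT.isClosed_biUnion fun p _ => isClosed_gridBox N p

lemma preimage_swap_gridRegion (N : ℕ) (T : Set (ℕ × ℕ)) :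
    Prod.swap ⁻¹' gridRegion N T = gridRegion N (Prod.swap ⁻¹' T) := by
  ext s
  simp only [gridRegion, Set.mem_preimage, Set.mem_iUnion, exists_prop]
  exact ⟨fun ⟨p, hp, hs⟩ => ⟨p.swap, hp, hs.symm⟩, fun ⟨p, hp, hs⟩ => ⟨p.swap, hp, hs.symm⟩⟩

lemma preimage_swap_gridFractal (m : ℕ) (S : Set (ℕ × ℕ)) :
    Prod.swap ⁻¹' gridFractal m S = gridFractal m (Prod.swap ⁻¹' S) := by
  simp only [gridFractal, Set.preimage_iInter, preimage_swap_gridRegion, gridLevel_swap]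

lemma gridBox_tile_subset {M m : ℕ} (v : ℕ × ℕ) {r : ℕ × ℕ} (hr : r.1 < m ∧ r.2 < m) :
    gridBox (M * m) (tile m v r) ⊆ gridBox M v := by
  have coarsen : ∀ {i j : ℕ} {x : ℝ}, j < m →
      ((M * m : ℕ) : ℝ) * x ∈ Set.Icc (((i * m + j : ℕ) : ℝ)) ((i * m + j : ℕ) + 1) →
      M * x ∈ Set.Icc (i : ℝ) (i + 1) := by
    rintro i j x hj ⟨h1, h2⟩
    have hm : (0 : ℝ) < m := by exact_mod_cast (Nat.zero_le j).trans_lt hj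
    have hj' : (j : ℝ) + 1 ≤ m := by exact_mod_cast hj
    push_cast at h1 h2
    constructor <;> refine le_of_mul_le_mul_right ?_ hm <;> linarith [j.cast_nonneg (α := ℝ)]
  exact fun s hs => ⟨coarsen hr.1 hs.1, coarsen hr.2 hs.2⟩

lemma gridRegion_subdivide_subset {M m : ℕ} {T S : Set (ℕ × ℕ)} (hS : ∀ r ∈ S, r.1 < m ∧ r.2 < m) :
    gridRegion (M * m) (subdivide m T S) ⊆ gridRegion M T := by
  refine Set.iUnion₂_subset ?_
  rintro _ ⟨v, hv, r, hr, rfl⟩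
  exact (gridBox_tile_subset v (hS r hr)).trans (Set.subset_biUnion_of_mem hv)

lemma exists_mem_Icc_nat {N : ℕ} (hN : 0 < N) {a : ℝ} (h0 : 0 ≤ a) (h1 : a ≤ N) :
    ∃ i < N, a ∈ Set.Icc (i : ℝ) (i + 1) := by
  rcases lt_or_eq_of_le h1 with h | rfl
  · exact ⟨⌊a⌋₊, (Nat.floor_lt h0).2 h, Nat.floor_le h0, (Nat.lt_floor_add_one a).le⟩
  · refine ⟨N - 1, by omega, ?_, ?_⟩ <;> rw [Nat.cast_sub hN] <;> simp

lemma exists_mem_gridBox {N : ℕ} (hN : 0 < N) {s : ℝ × ℝ} (hs : s ∈ unitSquare) :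
    ∃ p : ℕ × ℕ, p.1 < N ∧ p.2 < N ∧ s ∈ gridBox N p := by
  obtain ⟨⟨h1, h1'⟩, h2, h2'⟩ := hs
  obtain ⟨i, hi, hi'⟩ := exists_mem_Icc_nat hN (by positivity)
    (mul_le_of_le_one_right N.cast_nonneg h1')
  obtain ⟨j, hj, hj'⟩ := exists_mem_Icc_nat hN (by positivity)
    (mul_le_of_le_one_right N.cast_nonneg h2')
  exact ⟨(i, j), hi, hj, hi', hj'⟩

lemma le_add_one_of_mem_gridBox {N : ℕ} {p q : ℕ × ℕ} {s t : ℝ × ℝ} (hs : s ∈ gridBox N p)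
    (ht : t ∈ gridBox N q) (h : N * dist s t < 1) : p ≤ q + 1 := by
  have coord : ∀ {a b : ℕ} {x y : ℝ}, N * x ∈ Set.Icc (a : ℝ) (a + 1) →
      N * y ∈ Set.Icc (b : ℝ) (b + 1) → dist x y ≤ dist s t → a ≤ b + 1 := by
    intro a b x y hx hy hxy
    have hle : N * (x - y) ≤ N * dist s t := by
      gcongr
      exact (le_abs_self _).trans hxy
    have : (a : ℝ) < b + 2 := by linarith [hx.1, hy.2]
    exact Nat.lt_succ_iff.1 (by exact_mod_cast this)
  exact ⟨coord hs.1 ht.1 (le_max_left _ _), coord hs.2 ht.2 (le_max_right _ _)⟩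

lemma IsGridLabyrinth.inter_gridRegion_nonempty {N : ℕ} {T : Set (ℕ × ℕ)}
    (hT : IsGridLabyrinth N T) {K : Set (ℝ × ℝ)} (hK : IsPreconnected K) (hKs : K ⊆ unitSquare)
    {s t : ℝ × ℝ} (hs : s ∈ K) (ht : t ∈ K) (hs0 : s.1 = 0) (ht1 : t.1 = 1) :
    (K ∩ gridRegion N T).Nonempty := by
  by_contra hdisj
  have hN := hT.pos
  choose! p hp1 hp2 hp using fun u (hu : u ∈ K) => exists_mem_gridBox hN (hKs hu)
  have hpT : ∀ u ∈ K, p u ∉ T := fun u hu huT =>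
    hdisj ⟨u, hu, Set.mem_biUnion huT (hp u hu)⟩
  obtain ⟨F, hleft, hright, htouch⟩ := hT.exists_separating_labelling
  have hcont : ContinuousOn (F ∘ p) K := by
    intro u hu
    have hnear : ∀ᶠ v in nhdsWithin u K, N * dist v u < 1 :=
      nhdsWithin_le_nhds <| (by fun_prop : Continuous fun v => N * dist v u).tendsto u |>.eventually
        (gt_mem_nhds (by simp))
    refine (continuousWithinAt_const (b := F (p u))).congr_of_eventuallyEq ?_ rfl
    filter_upwards [hnear, self_mem_nhdsWithin] with v hvu hv
    exact htouch _ _ (hpT v hv) (hpT u hu) (hp2 v hv) (hp2 u hu)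
      (le_add_one_of_mem_gridBox (hp v hv) (hp u hu) hvu)
      (le_add_one_of_mem_gridBox (hp u hu) (hp v hv) (dist_comm v u ▸ hvu))
  have hs_left : (p s).1 = 0 := by
    have := (hp s hs).1.1
    rw [hs0, mul_zero] at this
    exact_mod_cast this.antisymm (Nat.cast_nonneg _)
  have ht_right : (p t).1 + 1 = N := by
    have := (hp t ht).1.2
    rw [ht1, mul_one] at this
    exact le_antisymm (hp1 t ht) (by exact_mod_cast this)
  have := hK.constant hcont hs ht
  rw [Function.comp_apply, Function.comp_apply, hleft _ hs_left,
    hright _ (hpT t ht) ht_right (hp2 t ht)] at this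
  exact zero_ne_one this

lemma IsGridLabyrinth.inter_gridFractal_nonempty {m : ℕ} {S : Set (ℕ × ℕ)}
    (hS : IsGridLabyrinth m S) {K : Set (ℝ × ℝ)} (hK : IsPreconnected K) (hKc : IsCompact K)
    (hKs : K ⊆ unitSquare) {s t : ℝ × ℝ} (hs : s ∈ K) (ht : t ∈ K) (hs0 : s.1 = 0)
    (ht1 : t.1 = 1) : (K ∩ gridFractal m S).Nonempty := by
  have hclosed : ∀ n, IsClosed (gridRegion (m ^ (n + 1)) (gridLevel m S n)) :=
    fun n => isClosed_gridRegion _ (isGridLabyrinth_gridLevel hS n).finite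
  rw [gridFractal, Set.inter_iInter]
  refine IsCompact.nonempty_iInter_of_sequence_nonempty_isCompact_isClosed _
    (fun n => Set.inter_subset_inter_right K ?_)
    (fun n => (isGridLabyrinth_gridLevel hS n).inter_gridRegion_nonempty hK hKs hs ht hs0 ht1)
    (hKc.inter_right (hclosed 0)) (fun n => hKc.isClosed.inter (hclosed n))
  rw [pow_succ m (n + 1)]
  exact gridRegion_subdivide_subset hS.lt

lemma IsGridLabyrinth.inter_gridFractal_nonempty_of_snd {m : ℕ} {S : Set (ℕ × ℕ)}
    (hS : IsGridLabyrinth m S) {K : Set (ℝ × ℝ)} (hK : IsPreconnected K) (hKc : IsCompact K)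
    (hKs : K ⊆ unitSquare) {s t : ℝ × ℝ} (hs : s ∈ K) (ht : t ∈ K) (hs0 : s.2 = 0)
    (ht1 : t.2 = 1) : (K ∩ gridFractal m S).Nonempty := by
  obtain ⟨_, ⟨u, hu, rfl⟩, hfrac⟩ := hS.swap.inter_gridFractal_nonempty
    (hK.image _ continuous_swap.continuousOn) (hKc.image continuous_swap)
    (by rintro _ ⟨u, hu, rfl⟩; exact (hKs hu).symm)
    (Set.mem_image_of_mem _ hs) (Set.mem_image_of_mem _ ht) hs0 ht1
  rw [← preimage_swap_gridFractal, Set.mem_preimage, Prod.swap_swap] at hfrac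
  exact ⟨u, hu, hfrac⟩

/-! ### Charts of quadrilaterals -/

/-- The vertices of `R` are in convex position and named anticlockwise: the path along them makes
strict left turns only. -/
def Quad.IsLeftTurning (R : Quad) : Prop := ∀ i, 0 < turn (R i) (R (i + 1)) (R (i + 2))

/-- The vertices of the unit square that correspond to those of a quadrilateral. -/
def unitVertex : Fin 4 → ℝ × ℝ := ![(0, 0), (1, 0), (1, 1), (0, 1)]

/-- The representation of the point `s` in the unit square with vertices `unitVertex`: it is
`(1 - s.1, s.1 - s.2, s.2, 0)` below and `(1 - s.2, 0, s.1, s.2 - s.1)` above the diagonal, which is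
linear in `s.1`, `s.2` and `max s.1 s.2`. -/
def squareRep (s : ℝ × ℝ) : Fin 4 → ℝ :=
  ![1 - max s.1 s.2, max s.1 s.2 - s.2, s.1 + s.2 - max s.1 s.2, max s.1 s.2 - s.1]

/-- The map of the unit square onto a quadrilateral `R` that is affine on the two triangles
below and above the diagonal and maps the vertices of the square to those of `R`. -/
noncomputable def chart (R : Quad) (s : ℝ × ℝ) : Plane := ∑ i, squareRep s i • R i

/-- The inverse of `chart R`: `α₁`, `α₂`, `α₃` are barycentric coordinates of `x` in one of the
triangles `R₀R₁R₂` (then `α₃ = 0`) and `R₀R₂R₃` (then `α₁ = 0`), as quotients of areas. -/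
noncomputable def unchart (R : Quad) (x : Plane) : ℝ × ℝ :=
  let α₁ := max (-turn (R 0) (R 2) x) 0 / turn (R 0) (R 1) (R 2)
  let α₃ := max (turn (R 0) (R 2) x) 0 / turn (R 0) (R 2) (R 3)
  let α₂ := (turn (R 0) (R 1) x - α₃ * turn (R 0) (R 1) (R 3)) / turn (R 0) (R 1) (R 2)
  (α₁ + α₂, α₂ + α₃)

lemma continuous_unchart (R : Quad) : Continuous (unchart R) := by
  unfold unchart turn
  fun_prop

lemma turn_sum (a b : Plane) (R : Quad) {α : Fin 4 → ℝ} (h : ∑ i, α i = 1) :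
    turn a b (∑ i, α i • R i) = ∑ i, α i * turn a b (R i) := by
  simp only [Fin.sum_univ_four] at h ⊢
  have h0 : α 0 = 1 - α 1 - α 2 - α 3 := by linarith
  simp only [turn, PiLp.add_apply, PiLp.smul_apply, smul_eq_mul, h0]
  ring

lemma turn_rotate (a b c : Plane) : turn b c a = turn a b c := by
  simp only [turn]; ring

lemma turn_swap (a b c : Plane) : turn a c b = -turn a b c := by
  simp only [turn]; ring

lemma turn_self (a b : Plane) : turn a b a = 0 := by
  simp only [turn]; ring

lemma turn_self_right (a b : Plane) : turn a b b = 0 := by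
  simp only [turn]; ring

lemma Quad.IsLeftTurning.turn_pos {Q : Quad} (hQ : Q.IsLeftTurning) :
    0 < turn (Q 0) (Q 1) (Q 2) ∧ 0 < turn (Q 1) (Q 2) (Q 3) ∧ 0 < turn (Q 0) (Q 2) (Q 3) ∧
      0 < turn (Q 0) (Q 1) (Q 3) :=
  ⟨hQ 0, hQ 1, turn_rotate (Q 0) (Q 2) (Q 3) ▸ hQ 2,
    turn_rotate (Q 0) (Q 1) (Q 3) ▸ turn_rotate (Q 1) (Q 3) (Q 0) ▸ hQ 3⟩

lemma squareRep_nonneg {s : ℝ × ℝ} (hs : s ∈ unitSquare) (i : Fin 4) : 0 ≤ squareRep s i := by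
  obtain ⟨⟨h1, h2⟩, h3, h4⟩ := hs
  rcases le_total s.1 s.2 with h | h <;> fin_cases i <;> simp [squareRep, h, h1, h2, h3, h4]

lemma sum_squareRep (s : ℝ × ℝ) : ∑ i, squareRep s i = 1 := by
  simp only [squareRep, Fin.sum_univ_four, Matrix.cons_val]
  ring

lemma squareRep_triangle (s : ℝ × ℝ) : squareRep s 1 = 0 ∨ squareRep s 3 = 0 := by
  rcases le_total s.1 s.2 with h | h <;> simp [squareRep, h]

lemma isRep_chart (Q : Quad) {s : ℝ × ℝ} (hs : s ∈ unitSquare) :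
    IsRep Q (chart Q s) (squareRep s) :=
  ⟨squareRep_nonneg hs, sum_squareRep s, rfl, squareRep_triangle s⟩

section

variable {Q : Quad} {x : Plane} {α : Fin 4 → ℝ}

lemma IsRep.unchart_eq (hQ : Q.IsLeftTurning) (h : IsRep Q x α) :
    unchart Q x = (α 1 + α 2, α 2 + α 3) := by
  obtain ⟨h012, -, h023, -⟩ := hQ.turn_pos
  have area_diagonal := turn_sum (Q 0) (Q 2) Q h.sum_eq_one
  have area_side := turn_sum (Q 0) (Q 1) Q h.sum_eq_one
  simp only [h.sum_smul, Fin.sum_univ_four, turn_self, turn_self_right,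
    turn_swap (Q 0) (Q 1) (Q 2), mul_zero, zero_add, add_zero] at area_diagonal area_side
  have n1 : 0 ≤ α 1 * turn (Q 0) (Q 1) (Q 2) := mul_nonneg (h.nonneg 1) h012.le
  have n3 : 0 ≤ α 3 * turn (Q 0) (Q 2) (Q 3) := mul_nonneg (h.nonneg 3) h023.le
  have coord₁ : max (-turn (Q 0) (Q 2) x) 0 = α 1 * turn (Q 0) (Q 1) (Q 2) := by
    rcases h.triangle with h0 | h0 <;> simp only [h0, zero_mul] at * <;> simp_all
  have coord₃ : max (turn (Q 0) (Q 2) x) 0 = α 3 * turn (Q 0) (Q 2) (Q 3) := by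
    rcases h.triangle with h0 | h0 <;> simp only [h0, zero_mul] at * <;> simp_all
  simp only [unchart, coord₁, coord₃, area_side, mul_div_cancel_right₀ _ h012.ne',
    mul_div_cancel_right₀ _ h023.ne', add_sub_cancel_right]

lemma IsRep.eq_squareRep (hQ : Q.IsLeftTurning) (h : IsRep Q x α) :
    α = squareRep (unchart Q x) := by
  have hsum := h.sum_eq_one
  rw [Fin.sum_univ_four] at hsum
  have hmax : max (α 1 + α 2) (α 2 + α 3) = α 1 + α 2 + α 3 := by
    rcases h.triangle with h0 | h0 <;> simp [h0, h.nonneg]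
  rw [h.unchart_eq hQ]
  ext i
  fin_cases i <;> (simp [squareRep, hmax]; try linarith)

end

lemma unchart_chart {Q : Quad} (hQ : Q.IsLeftTurning) {s : ℝ × ℝ} (hs : s ∈ unitSquare) :
    unchart Q (chart Q s) = s := by
  rw [(isRep_chart Q hs).unchart_eq hQ]
  ext <;> simp [squareRep]

lemma P_chart {Q : Quad} (hQ : Q.IsLeftTurning) (R : Quad) {s : ℝ × ℝ} (hs : s ∈ unitSquare) :
    P Q R (chart Q s) = chart R s := by
  have h : IsRep Q (chart Q s) (rep Q (chart Q s)) := Classical.epsilon_spec ⟨_, isRep_chart Q hs⟩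
  rw [P, h.eq_squareRep hQ, unchart_chart hQ hs, chart]

lemma region_eq_image_stdSimplex (R : Quad) :
    R.region = Fintype.linearCombination ℝ R '' stdSimplex ℝ (Fin 4) := by
  rw [← convexHull_rangle_single_eq_stdSimplex, LinearMap.image_convexHull, ← Set.range_comp]
  simp [Quad.region, Function.comp_def, Fintype.linearCombination_apply_single]

lemma chart_mem_region (R : Quad) {s : ℝ × ℝ} (hs : s ∈ unitSquare) : chart R s ∈ R.region := by
  rw [region_eq_image_stdSimplex]
  exact ⟨squareRep s, ⟨squareRep_nonneg hs, sum_squareRep s⟩, rfl⟩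

lemma sum_turn_relation (Q : Quad) :
    turn (Q 1) (Q 2) (Q 3) + turn (Q 0) (Q 1) (Q 3) =
      turn (Q 0) (Q 2) (Q 3) + turn (Q 0) (Q 1) (Q 2) := by
  simp only [turn]; ring

lemma sum_turn_smul_relation (Q : Quad) :
    turn (Q 1) (Q 2) (Q 3) • Q 0 + turn (Q 0) (Q 1) (Q 3) • Q 2 =
      turn (Q 0) (Q 2) (Q 3) • Q 1 + turn (Q 0) (Q 1) (Q 2) • Q 3 := by
  ext i
  fin_cases i <;> simp [turn] <;> ring

/-- Barycentric weights on the four vertices are shifted along the affine relation between the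
vertices until the weight of the second or of the fourth one vanishes. -/
lemma exists_isRep {Q : Quad} (hQ : Q.IsLeftTurning) {x : Plane} (hx : x ∈ Q.region) :
    ∃ α, IsRep Q x α := by
  rw [region_eq_image_stdSimplex] at hx
  obtain ⟨β, ⟨h0, h1⟩, rfl⟩ := hx
  obtain ⟨h012, h123, h023, h013⟩ := hQ.turn_pos
  set t := min (β 1 / turn (Q 0) (Q 2) (Q 3)) (β 3 / turn (Q 0) (Q 1) (Q 2))
  have ht0 : 0 ≤ t := le_min (div_nonneg (h0 1) h023.le) (div_nonneg (h0 3) h012.le)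
  have ht1 : t * turn (Q 0) (Q 2) (Q 3) ≤ β 1 := (le_div_iff₀ h023).1 (min_le_left _ _)
  have ht3 : t * turn (Q 0) (Q 1) (Q 2) ≤ β 3 := (le_div_iff₀ h012).1 (min_le_right _ _)
  refine ⟨![β 0 + t * turn (Q 1) (Q 2) (Q 3), β 1 - t * turn (Q 0) (Q 2) (Q 3),
    β 2 + t * turn (Q 0) (Q 1) (Q 3), β 3 - t * turn (Q 0) (Q 1) (Q 2)], ?_, ?_, ?_, ?_⟩
  · intro i
    fin_cases i
    · exact add_nonneg (h0 0) (by positivity)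
    · exact sub_nonneg.2 ht1
    · exact add_nonneg (h0 2) (by positivity)
    · exact sub_nonneg.2 ht3
  · simp only [Fin.sum_univ_four, Matrix.cons_val] at h1 ⊢
    linear_combination h1 + t * sum_turn_relation Q
  · simp only [Fintype.linearCombination_apply, Fin.sum_univ_four, Matrix.cons_val]
    linear_combination (norm := module) t • sum_turn_smul_relation Q
  · simp only [Matrix.cons_val, sub_eq_zero, ← div_eq_iff h023.ne', ← div_eq_iff h012.ne']
    exact (min_choice _ _).imp Eq.symm Eq.symm

lemma chart_unchart {Q : Quad} (hQ : Q.IsLeftTurning) {x : Plane} (hx : x ∈ Q.region) :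
    chart Q (unchart Q x) = x := by
  obtain ⟨α, hα⟩ := exists_isRep hQ hx
  rw [chart, ← hα.eq_squareRep hQ, hα.sum_smul]

lemma unchart_mem {Q : Quad} (hQ : Q.IsLeftTurning) {x : Plane} (hx : x ∈ Q.region) :
    unchart Q x ∈ unitSquare := by
  obtain ⟨α, hα⟩ := exists_isRep hQ hx
  have hsum := hα.sum_eq_one
  rw [Fin.sum_univ_four] at hsum
  have := hα.nonneg
  rw [hα.unchart_eq hQ]
  exact ⟨⟨add_nonneg (this 1) (this 2), by linarith [this 0, this 3]⟩,
    add_nonneg (this 2) (this 3), by linarith [this 0, this 1]⟩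

lemma image_chart_unitSquare {Q : Quad} (hQ : Q.IsLeftTurning) :
    chart Q '' unitSquare = Q.region :=
  (Set.image_subset_iff.2 fun _ hs => chart_mem_region Q hs).antisymm fun x hx =>
    ⟨unchart Q x, unchart_mem hQ hx, chart_unchart hQ hx⟩

lemma chart_unitVertex (R : Quad) (i : Fin 4) : chart R (unitVertex i) = R i := by
  fin_cases i <;> simp [chart, squareRep, unitVertex, Fin.sum_univ_four]

lemma unitVertex_mem (i : Fin 4) : unitVertex i ∈ unitSquare := by
  fin_cases i <;> simp [unitVertex, unitSquare]

lemma unchart_vertex {Q : Quad} (hQ : Q.IsLeftTurning) (i : Fin 4) :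
    unchart Q (Q i) = unitVertex i := by
  rw [← chart_unitVertex Q i, unchart_chart hQ (unitVertex_mem i)]

/-! ### Quadrilaterals of grid squares -/

/-- The affine map of the unit square onto the square `p` of the `N × N` grid. -/
noncomputable def place (N : ℕ) (p : ℕ × ℕ) (s : ℝ × ℝ) : ℝ × ℝ :=
  ((p.1 + s.1) / N, (p.2 + s.2) / N)

lemma image_place_unitSquare {N : ℕ} (hN : 0 < N) (p : ℕ × ℕ) :
    place N p '' unitSquare = gridBox N p := by
  have hN' : (N : ℝ) ≠ 0 := by positivity
  ext s
  simp only [Set.mem_image, gridBox, place, unitSquare, Set.mem_prod, Set.mem_Icc,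
    Set.mem_ofPred_eq]
  constructor
  · rintro ⟨t, ⟨⟨h1, h2⟩, h3, h4⟩, rfl⟩
    simp only [mul_div_cancel₀ _ hN']
    exact ⟨⟨by linarith, by linarith⟩, by linarith, by linarith⟩
  · rintro ⟨⟨h1, h2⟩, h3, h4⟩
    refine ⟨(N * s.1 - p.1, N * s.2 - p.2),
      ⟨⟨sub_nonneg.2 h1, ?_⟩, sub_nonneg.2 h3, ?_⟩, ?_⟩
    · simp only; linarith
    · simp only; linarith
    · ext <;> simp only [add_sub_cancel, mul_div_cancel_left₀ _ hN']

lemma gridBox_subset_unitSquare {N : ℕ} {p : ℕ × ℕ} (hp : p.1 < N ∧ p.2 < N) :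
    gridBox N p ⊆ unitSquare := by
  have bound : ∀ {i : ℕ} {x : ℝ}, i < N → N * x ∈ Set.Icc (i : ℝ) (i + 1) →
      x ∈ Set.Icc (0 : ℝ) 1 := by
    rintro i x hi ⟨h1, h2⟩
    have hN : (0 : ℝ) < N := by exact_mod_cast (Nat.zero_le i).trans_lt hi
    have hi' : (i : ℝ) + 1 ≤ N := by exact_mod_cast hi
    exact ⟨nonneg_of_mul_nonneg_right ((Nat.cast_nonneg i).trans h1) hN,
      le_of_mul_le_mul_left (by linarith) hN⟩
  exact fun s hs => ⟨bound hp.1 hs.1, bound hp.2 hs.2⟩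

lemma place_mem_unitSquare {N : ℕ} {p : ℕ × ℕ} (hp : p.1 < N ∧ p.2 < N) {s : ℝ × ℝ}
    (hs : s ∈ unitSquare) : place N p s ∈ unitSquare :=
  gridBox_subset_unitSquare hp <|
    (image_place_unitSquare ((Nat.zero_le _).trans_lt hp.1) p).subset ⟨s, hs, rfl⟩

lemma place_place (M : ℕ) {m : ℕ} (hm : 0 < m) (v r : ℕ × ℕ) (s : ℝ × ℝ) :
    place M v (place m r s) = place (M * m) (tile m v r) s := by
  have hm' : (m : ℝ) ≠ 0 := by positivity
  have coord : ∀ (i j : ℕ) (x : ℝ),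
      (i + (j + x) / m) / M = ((i * m + j : ℕ) + x) / (M * m : ℕ) := by
    intro i j x
    rw [Nat.cast_mul, mul_comm (M : ℝ), ← div_div]
    push_cast
    field_simp
    ring
  exact Prod.ext (coord _ _ _) (coord _ _ _)

/-- The quadrilateral that corresponds in `chart Q` to the square `p` of the `N × N` grid. -/
noncomputable def gridSquare (Q : Quad) (N : ℕ) (p : ℕ × ℕ) : Quad := fun i =>
  chart Q (place N p (unitVertex i))

/-- `max s.1 s.2` is affine on both halves of each square of the grid: the squares off the diagonal
do not cross it, and the diagonal cuts those along it in the same way as the unit square. -/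
lemma sum_squareRep_mul_max (p : ℕ × ℕ) {s : ℝ × ℝ} (hs : s ∈ unitSquare) :
    ∑ i, squareRep s i * max (p.1 + (unitVertex i).1) (p.2 + (unitVertex i).2) =
      max (p.1 + s.1) (p.2 + s.2) := by
  obtain ⟨a, b⟩ := p
  obtain ⟨⟨h1, h2⟩, h3, h4⟩ := hs
  simp only [Fin.sum_univ_four, squareRep, unitVertex, Matrix.cons_val]
  rcases lt_trichotomy a b with hab | rfl | hab
  · have hab' : (a : ℝ) + 1 ≤ b := by exact_mod_cast hab
    have hmax : ∀ {x y : ℝ}, x ≤ 1 → 0 ≤ y → max (a + x) (b + y) = b + y := fun hx hy =>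
      max_eq_right (by linarith)
    simp only [hmax, h2, h3, le_refl, zero_le_one]
    ring
  · simp only [max_add_add_left, max_self, zero_le_one, max_eq_left, max_eq_right]
    ring
  · have hab' : (b : ℝ) + 1 ≤ a := by exact_mod_cast hab
    have hmax : ∀ {x y : ℝ}, 0 ≤ x → y ≤ 1 → max (a + x) (b + y) = a + x := fun hx hy =>
      max_eq_left (by linarith)
    simp only [hmax, h1, h4, le_refl, zero_le_one]
    ring

lemma sum_squareRep_mul_squareRep_place (N : ℕ) (p : ℕ × ℕ) {s : ℝ × ℝ} (hs : s ∈ unitSquare)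
    (j : Fin 4) : ∑ i, squareRep s i * squareRep (place N p (unitVertex i)) j =
      squareRep (place N p s) j := by
  have hmax := sum_squareRep_mul_max p hs
  simp only [Fin.sum_univ_four] at hmax ⊢
  fin_cases j
  all_goals
    simp only [squareRep, place, max_div_div_right (Nat.cast_nonneg (α := ℝ) N), ← hmax]
    simp [unitVertex]
    ring

lemma chart_gridSquare (Q : Quad) (N : ℕ) (p : ℕ × ℕ) {s : ℝ × ℝ} (hs : s ∈ unitSquare) :
    chart (gridSquare Q N p) s = chart Q (place N p s) := by
  simp only [chart, gridSquare, Finset.smul_sum, smul_smul]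
  rw [Finset.sum_comm]
  simp only [← Finset.sum_smul, sum_squareRep_mul_squareRep_place N p hs]

lemma gridSquare_tile {Q : Quad} (hQ : Q.IsLeftTurning) (M : ℕ) {m : ℕ} (v : ℕ × ℕ) {r : ℕ × ℕ}
    (hr : r.1 < m ∧ r.2 < m) :
    gridSquare Q (M * m) (tile m v r) = fun i => P Q (gridSquare Q M v) (gridSquare Q m r i) := by
  ext1 i
  have hmem := place_mem_unitSquare hr (unitVertex_mem i)
  rw [gridSquare, gridSquare, P_chart hQ _ hmem, chart_gridSquare Q M v hmem,
    place_place M ((Nat.zero_le _).trans_lt hr.1)]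

lemma image_chart_gridBox_subset (Q : Quad) {N : ℕ} (hN : 0 < N) (p : ℕ × ℕ) :
    chart Q '' gridBox N p ⊆ (gridSquare Q N p).region := by
  rw [← image_place_unitSquare hN, ← Set.image_comp]
  rintro _ ⟨s, hs, rfl⟩
  rw [Function.comp_apply, ← chart_gridSquare Q N p hs]
  exact chart_mem_region _ hs

lemma chart_injOn {Q : Quad} (hQ : Q.IsLeftTurning) : Set.InjOn (chart Q) unitSquare :=
  Set.LeftInvOn.injOn fun _ => unchart_chart hQ

lemma add_unitVertex_eq_of_gridSquare_eq {Q : Quad} (hQ : Q.IsLeftTurning) {N : ℕ} {p q : ℕ × ℕ}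
    (hp : p.1 < N ∧ p.2 < N) (hq : q.1 < N ∧ q.2 < N) {i j : Fin 4}
    (h : gridSquare Q N p i = gridSquare Q N q j) :
    p.1 + (unitVertex i).1 = q.1 + (unitVertex j).1 ∧
      p.2 + (unitVertex i).2 = q.2 + (unitVertex j).2 := by
  have hN : (N : ℝ) ≠ 0 := by exact_mod_cast ((Nat.zero_le _).trans_lt hp.1).ne'
  have := chart_injOn hQ (place_mem_unitSquare hp (unitVertex_mem i))
    (place_mem_unitSquare hq (unitVertex_mem j)) h
  simpa only [place, Prod.mk.injEq, div_left_inj' hN] using this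

lemma gridSquare_injOn {Q : Quad} (hQ : Q.IsLeftTurning) (N : ℕ) :
    Set.InjOn (gridSquare Q N) {p | p.1 < N ∧ p.2 < N} := by
  intro p hp q hq h
  simpa [unitVertex, Prod.ext_iff] using
    add_unitVertex_eq_of_gridSquare_eq hQ hp hq (congrFun h 0)

lemma gridGraph_adj_of_common_side {Q : Quad} (hQ : Q.IsLeftTurning) {N : ℕ} {p q : ℕ × ℕ}
    (hp : p.1 < N ∧ p.2 < N) (hq : q.1 < N ∧ q.2 < N) (hpq : p ≠ q)
    (h : ((gridSquare Q N p).sides ∩ (gridSquare Q N q).sides).Nonempty) : gridGraph.Adj p q := by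
  obtain ⟨_, ⟨i, rfl⟩, j, hij⟩ := h
  have key := (Sym2.eq_iff.1 hij).imp
    (fun h => And.intro (add_unitVertex_eq_of_gridSquare_eq hQ hp hq h.1)
      (add_unitVertex_eq_of_gridSquare_eq hQ hp hq h.2))
    (fun h => And.intro (add_unitVertex_eq_of_gridSquare_eq hQ hp hq h.1)
      (add_unitVertex_eq_of_gridSquare_eq hQ hp hq h.2))
  clear hij hp hq
  rw [ne_eq, Prod.ext_iff] at hpq
  rw [gridGraph_adj]
  fin_cases i <;> fin_cases j <;> simp [unitVertex] at key <;> norm_cast at key <;> omega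

/-! ### Cells and white quadrilaterals -/

/-- The position in the grid of the square that corresponds to the cell with index `k`. The side
`Q₁Q₂`, on which the left exit lies, corresponds to the bottom row and `Q₁Q₄` to the left column. -/
def gridPos (k : Fin 4 → ℕ) : ℕ × ℕ := (k 1 + k 2, k 2 + k 3)

lemma gridPos_lt {m : ℕ} {k : Fin 4 → ℕ} (hk : k ∈ A m) :
    (gridPos k).1 < m ∧ (gridPos k).2 < m := by
  obtain (⟨h, h', -⟩ | ⟨h, h', -⟩) | ⟨h, h', h''⟩ := hk <;> simp only [gridPos] <;> omega

lemma chart_place_of_le {Q : Quad} {N : ℕ} (hN : 0 < N) {p : ℕ × ℕ} {s : ℝ × ℝ}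
    (h : p.2 + s.2 ≤ p.1 + s.1) :
    chart Q (place N p s) = (N : ℝ)⁻¹ • ((N - (p.1 + s.1)) • Q 0 +
      (p.1 + s.1 - (p.2 + s.2)) • Q 1 + (p.2 + s.2) • Q 2) := by
  have hN' : (N : ℝ) ≠ 0 := by positivity
  simp only [chart, squareRep, place, max_div_div_right (Nat.cast_nonneg (α := ℝ) N),
    max_eq_left h, Fin.sum_univ_four, Matrix.cons_val]
  match_scalars <;> field_simp <;> ring

lemma chart_place_of_ge {Q : Quad} {N : ℕ} (hN : 0 < N) {p : ℕ × ℕ} {s : ℝ × ℝ}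
    (h : p.1 + s.1 ≤ p.2 + s.2) :
    chart Q (place N p s) = (N : ℝ)⁻¹ • ((N - (p.2 + s.2)) • Q 0 +
      (p.1 + s.1) • Q 2 + (p.2 + s.2 - (p.1 + s.1)) • Q 3) := by
  have hN' : (N : ℝ) ≠ 0 := by positivity
  simp only [chart, squareRep, place, max_div_div_right (Nat.cast_nonneg (α := ℝ) N),
    max_eq_right h, Fin.sum_univ_four, Matrix.cons_val]
  match_scalars <;> field_simp <;> ring

lemma gridSquare_gridPos (Q : Quad) {m : ℕ} {k : Fin 4 → ℕ} (hk : k ∈ A m) :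
    gridSquare Q m (gridPos k) = cell Q m k := by
  have hm : 0 < m := (Nat.zero_le _).trans_lt (gridPos_lt hk).1
  ext1 i
  obtain (⟨rfl, h3, h1⟩ | ⟨rfl, h1, h3⟩) | ⟨rfl, h1, h3⟩ := hk
  · rw [gridSquare, chart_place_of_le hm
      (by fin_cases i <;> simp [gridPos, unitVertex, h3] <;> norm_cast <;> omega)]
    fin_cases i <;> simp [cell, h1, h3, gridPos, unitVertex, Fin.sum_univ_four] <;> module
  · rw [gridSquare, chart_place_of_ge hm
      (by fin_cases i <;> simp [gridPos, unitVertex, h1] <;> norm_cast <;> omega)]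
    fin_cases i <;> simp [cell, h1, h3, gridPos, unitVertex, Fin.sum_univ_four] <;> module
  · rw [gridSquare]
    rcases le_total (unitVertex i).1 (unitVertex i).2 with h | h
    · rw [chart_place_of_ge hm (by simp [gridPos, h1, h3, h])]
      fin_cases i <;> norm_num [unitVertex] at h <;>
        simp [cell, h1, h3, gridPos, unitVertex, Fin.sum_univ_four] <;> module
    · rw [chart_place_of_le hm (by simp [gridPos, h1, h3, h])]
      fin_cases i <;> norm_num [unitVertex] at h <;>
        simp [cell, h1, h3, gridPos, unitVertex, Fin.sum_univ_four] <;> module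

lemma isLeftTurning_cell {Q : Quad} (hQ : Q.IsLeftTurning) {m : ℕ} (hm : 0 < m) (k : Fin 4 → ℕ) :
    (cell Q m k).IsLeftTurning := by
  obtain ⟨h012, -, h023, -⟩ := hQ.turn_pos
  have hc : 0 < (m : ℝ)⁻¹ ^ 2 := by positivity
  intro i
  simp only [cell]
  split_ifs
  · refine (mul_pos hc h012).trans_eq ?_
    fin_cases i <;> simp [turn] <;> ring
  · refine (mul_pos hc h023).trans_eq ?_
    fin_cases i <;> simp [turn] <;> ring
  · refine (mul_pos hc (hQ i)).trans_eq ?_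
    fin_cases i <;> simp [turn] <;> ring

lemma region_cell {Q : Quad} (hQ : Q.IsLeftTurning) {m : ℕ} {k : Fin 4 → ℕ} (hk : k ∈ A m) :
    (cell Q m k).region = chart Q '' gridBox m (gridPos k) := by
  have hm : 0 < m := (Nat.zero_le _).trans_lt (gridPos_lt hk).1
  rw [← image_chart_unitSquare (isLeftTurning_cell hQ hm k), ← gridSquare_gridPos Q hk,
    ← image_place_unitSquare hm, Set.image_image]
  exact Set.image_congr fun s hs => chart_gridSquare Q m _ hs

lemma eq_single_of_vertex_mem_region_cell {Q : Quad} (hQ : Q.IsLeftTurning) {m : ℕ}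
    {k : Fin 4 → ℕ} (hk : k ∈ A m) {i : Fin 4} (h : Q i ∈ (cell Q m k).region) :
    k = Pi.single i (m - 1) := by
  rw [region_cell hQ hk] at h
  obtain ⟨s, hs, hsi⟩ := h
  have hs' := gridBox_subset_unitSquare (gridPos_lt hk) hs
  obtain rfl : s = unitVertex i := by rw [← unchart_vertex hQ, ← hsi, unchart_chart hQ hs']
  obtain ⟨⟨hl, hl'⟩, hb, hb'⟩ := hs
  clear hsi hs'
  ext j
  fin_cases i <;> simp [gridPos, unitVertex] at hl hl' hb hb' <;> norm_cast at hl hl' hb hb' <;>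
    obtain (⟨h, h', -⟩ | ⟨h, h', -⟩) | ⟨h, h', h''⟩ := hk <;>
    fin_cases j <;> simp <;> omega

/-- The positions in the grid of the white squares. -/
def pattern (Q : Quad) (m : ℕ) (W : Set Quad) : Set (ℕ × ℕ) :=
  gridPos '' {k ∈ A m | cell Q m k ∈ W}

section

variable {Q : Quad} {m : ℕ} {W : Set Quad}

lemma lt_of_mem_pattern {p : ℕ × ℕ} (hp : p ∈ pattern Q m W) : p.1 < m ∧ p.2 < m := by
  obtain ⟨k, hk, rfl⟩ := hp
  exact gridPos_lt hk.1

lemma gridSquare_mem_of_mem_pattern {p : ℕ × ℕ} (hp : p ∈ pattern Q m W) :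
    gridSquare Q m p ∈ W := by
  obtain ⟨k, ⟨hk, hW⟩, rfl⟩ := hp
  rwa [gridSquare_gridPos Q hk]

lemma exists_mem_pattern (hW : W ⊆ cells Q m) {U : Quad} (hU : U ∈ W) :
    ∃ p ∈ pattern Q m W, gridSquare Q m p = U := by
  obtain ⟨k, hk, rfl⟩ := hW hU
  exact ⟨gridPos k, ⟨k, ⟨hk, hU⟩, rfl⟩, gridSquare_gridPos Q hk⟩

lemma preconnected_pattern (hQ : Q.IsLeftTurning) (hW : W ⊆ cells Q m)
    (hconn : (whiteGraph W).Preconnected) : (gridGraph.induce (pattern Q m W)).Preconnected := by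
  choose pos hpos hsquare using fun U : W => exists_mem_pattern hW U.2
  have hadj : ∀ {U V}, (whiteGraph W).Adj U V → gridGraph.Adj (pos U) (pos V) := by
    intro U V h
    refine gridGraph_adj_of_common_side hQ (lt_of_mem_pattern (hpos U)) (lt_of_mem_pattern (hpos V))
      (fun hUV => h.1 (Subtype.ext ?_)) ?_
    · rw [← hsquare U, hUV, hsquare V]
    · rw [hsquare, hsquare]
      exact h.2
  let posHom : whiteGraph W →g gridGraph.induce (pattern Q m W) := ⟨fun U => ⟨pos U, hpos U⟩, hadj⟩
  refine hconn.map posHom fun ⟨p, hp⟩ => ⟨⟨_, gridSquare_mem_of_mem_pattern hp⟩, ?_⟩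
  exact Subtype.ext <| gridSquare_injOn hQ m (lt_of_mem_pattern (hpos _)) (lt_of_mem_pattern hp)
    (hsquare _)

lemma isGridLabyrinth_pattern (hQ : Q.IsLeftTurning) (hW : W ⊆ cells Q m)
    (hconn : (whiteGraph W).Preconnected)
    (hlr : ∃ p : ℕ × ℕ, ![p.1, p.2, 0, 0] ∈ A m ∧
      cell Q m ![p.1, p.2, 0, 0] ∈ W ∧ cell Q m ![0, 0, p.2, p.1] ∈ W)
    (htb : ∃ p : ℕ × ℕ, ![p.1, 0, 0, p.2] ∈ A m ∧
      cell Q m ![p.1, 0, 0, p.2] ∈ W ∧ cell Q m ![0, p.1, p.2, 0] ∈ W) :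
    IsGridLabyrinth m (pattern Q m W) where
  lt _ := lt_of_mem_pattern
  preconnected := preconnected_pattern hQ hW hconn
  exit_bottom_top := by
    obtain ⟨⟨a, b⟩, hA, h1, h2⟩ := hlr
    simp only [A, A₁, A₂, A₃, Set.mem_union, Set.mem_ofPred_eq, Matrix.cons_val] at hA
    refine ⟨b, ⟨_, ⟨?_, h1⟩, ?_⟩, ⟨_, ⟨?_, h2⟩, ?_⟩⟩ <;> simp [A, A₁, A₂, A₃, gridPos] <;> omega
  exit_left_right := by
    obtain ⟨⟨a, b⟩, hA, h1, h2⟩ := htb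
    simp only [A, A₁, A₂, A₃, Set.mem_union, Set.mem_ofPred_eq, Matrix.cons_val] at hA
    refine ⟨b, ⟨_, ⟨?_, h1⟩, ?_⟩, ⟨_, ⟨?_, h2⟩, ?_⟩⟩ <;> simp [A, A₁, A₂, A₃, gridPos] <;> omega

lemma gridSquare_mem_white (hQ : Q.IsLeftTurning) {n : ℕ} {p : ℕ × ℕ}
    (hp : p ∈ gridLevel m (pattern Q m W) n) : gridSquare Q (m ^ (n + 1)) p ∈ white Q W n := by
  induction n generalizing p with
  | zero =>
    rw [zero_add, pow_one]
    exact gridSquare_mem_of_mem_pattern hp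
  | succ n ih =>
    obtain ⟨v, hv, r, hr, rfl⟩ := hp
    rw [pow_succ, gridSquare_tile hQ _ _ (lt_of_mem_pattern hr)]
    exact ⟨_, ih hv, _, gridSquare_mem_of_mem_pattern hr, rfl⟩

lemma chart_mem_fractal (hQ : Q.IsLeftTurning) (hm : 0 < m) {s : ℝ × ℝ}
    (hs : s ∈ gridFractal m (pattern Q m W)) : chart Q s ∈ fractal Q W := by
  refine Set.mem_iInter.2 fun n => ?_
  obtain ⟨p, hp, hsp⟩ := Set.mem_iUnion₂.1 (Set.mem_iInter.1 hs n)
  exact Set.mem_biUnion (gridSquare_mem_white hQ hp)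
    (image_chart_gridBox_subset Q (pow_pos hm _) p ⟨s, hsp, rfl⟩)

lemma cell_single_mem_of_vertex_mem_fractal (hQ : Q.IsLeftTurning) (hW : W ⊆ cells Q m)
    {i : Fin 4} (h : Q i ∈ fractal Q W) : cell Q m (Pi.single i (m - 1)) ∈ W := by
  obtain ⟨U, hU, hi⟩ := Set.mem_iUnion₂.1 (Set.mem_iInter.1 h 0)
  obtain ⟨k, hk, rfl⟩ := hW hU
  exact eq_single_of_vertex_mem_region_cell hQ hk hi ▸ hU

lemma IsGridLabyrinth.not_joinedIn (hQ : Q.IsLeftTurning)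
    (hS : IsGridLabyrinth m (pattern Q m W)) (i : Fin 4) :
    ¬ JoinedIn (Q.region \ fractal Q W) (Q i) (Q (i + 1)) := by
  rintro ⟨γ, hγ⟩
  set c : C(unitInterval, ℝ × ℝ) := ⟨unchart Q ∘ γ, (continuous_unchart Q).comp γ.continuous⟩
  have hK : IsPreconnected (Set.range c) := isPreconnected_range c.continuous
  have hKc : IsCompact (Set.range c) := isCompact_range c.continuous
  have hKs : Set.range c ⊆ unitSquare := Set.range_subset_iff.2 fun t => unchart_mem hQ (hγ t).1
  have hstart : unitVertex i ∈ Set.range c := ⟨0, by simp [c, unchart_vertex hQ]⟩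
  have hend : unitVertex (i + 1) ∈ Set.range c := ⟨1, by simp [c, unchart_vertex hQ]⟩
  suffices (Set.range c ∩ gridFractal m (pattern Q m W)).Nonempty by
    obtain ⟨_, ⟨t, rfl⟩, ht⟩ := this
    exact (hγ t).2 (chart_unchart hQ (hγ t).1 ▸ chart_mem_fractal hQ hS.pos ht)
  fin_cases i
  · exact hS.inter_gridFractal_nonempty hK hKc hKs hstart hend rfl rfl
  · exact hS.inter_gridFractal_nonempty_of_snd hK hKc hKs hstart hend rfl rfl
  · exact hS.inter_gridFractal_nonempty hK hKc hKs hend hstart rfl rfl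
  · exact hS.inter_gridFractal_nonempty_of_snd hK hKc hKs hend hstart rfl rfl

lemma exists_consecutive_vertices_notMem_fractal (hQ : Q.IsLeftTurning) (hW : W ⊆ cells Q m)
    (h₁₃ : ¬ (cell Q m ![m - 1, 0, 0, 0] ∈ W ∧ cell Q m ![0, 0, m - 1, 0] ∈ W))
    (h₂₄ : ¬ (cell Q m ![0, m - 1, 0, 0] ∈ W ∧ cell Q m ![0, 0, 0, m - 1] ∈ W)) :
    ∃ i, Q i ∉ fractal Q W ∧ Q (i + 1) ∉ fractal Q W := by
  have corner : ∀ i, Q i ∈ fractal Q W → cell Q m (Pi.single i (m - 1)) ∈ W :=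
    fun _ => cell_single_mem_of_vertex_mem_fractal hQ hW
  have single : ∀ i, (Pi.single i (m - 1) : Fin 4 → ℕ) = ![![m - 1, 0, 0, 0], ![0, m - 1, 0, 0],
      ![0, 0, m - 1, 0], ![0, 0, 0, m - 1]] i := by
    intro i
    ext j
    fin_cases i <;> fin_cases j <;> rfl
  simp only [single] at corner
  have not_both₀₂ : ¬ (Q 0 ∈ fractal Q W ∧ Q 2 ∈ fractal Q W) := fun h =>
    h₁₃ ⟨corner 0 h.1, corner 2 h.2⟩
  have not_both₁₃ : ¬ (Q 1 ∈ fractal Q W ∧ Q 3 ∈ fractal Q W) := fun h =>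
    h₂₄ ⟨corner 1 h.1, corner 3 h.2⟩
  by_cases h0 : Q 0 ∈ fractal Q W <;> by_cases h1 : Q 1 ∈ fractal Q W
  · exact ⟨2, fun h2 => not_both₀₂ ⟨h0, h2⟩, fun h3 => not_both₁₃ ⟨h1, h3⟩⟩
  · exact ⟨1, h1, fun h2 => not_both₀₂ ⟨h0, h2⟩⟩
  · exact ⟨3, fun h3 => not_both₁₃ ⟨h1, h3⟩, h0⟩
  · exact ⟨0, h0, h1⟩

end

theorem theorem4p3_general {Q : Quad} (hQ : Q.IsLeftTurning) {m : ℕ} {W : Set Quad}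
    (hW : W ⊆ cells Q m) (hconn : (whiteGraph W).Preconnected)
    (hlr : ∃ p : ℕ × ℕ, ![p.1, p.2, 0, 0] ∈ A m ∧
      cell Q m ![p.1, p.2, 0, 0] ∈ W ∧ cell Q m ![0, 0, p.2, p.1] ∈ W)
    (htb : ∃ p : ℕ × ℕ, ![p.1, 0, 0, p.2] ∈ A m ∧
      cell Q m ![p.1, 0, 0, p.2] ∈ W ∧ cell Q m ![0, p.1, p.2, 0] ∈ W)
    (h₁₃ : ¬ (cell Q m ![m - 1, 0, 0, 0] ∈ W ∧ cell Q m ![0, 0, m - 1, 0] ∈ W))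
    (h₂₄ : ¬ (cell Q m ![0, m - 1, 0, 0] ∈ W ∧ cell Q m ![0, 0, 0, m - 1] ∈ W)) :
    (Q.region \ fractal Q W).Nonempty ∧ ¬ IsPathConnected (Q.region \ fractal Q W) := by
  have vertex_mem : ∀ i, Q i ∈ Q.region := fun i => subset_convexHull ℝ _ ⟨i, rfl⟩
  obtain ⟨i, hi, hi'⟩ := exists_consecutive_vertices_notMem_fractal hQ hW h₁₃ h₂₄
  refine ⟨⟨Q i, vertex_mem i, hi⟩, fun h => ?_⟩
  exact (isGridLabyrinth_pattern hQ hW hconn hlr htb).not_joinedIn hQ i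
    (h.joinedIn _ ⟨vertex_mem i, hi⟩ _ ⟨vertex_mem _, hi'⟩)

end QuadLabyrinth

theorem theorem4p3 (Q : QuadLabyrinth.Quad) (hQ : QuadLabyrinth.IsConvexQuad Q)
    (m : ℕ) (W : Set QuadLabyrinth.Quad) (hW : QuadLabyrinth.IsLabyrinthSet Q m W) :
    (Q.region \ QuadLabyrinth.fractal Q W).Nonempty ∧
      ¬ IsPathConnected (Q.region \ QuadLabyrinth.fractal Q W) :=
  QuadLabyrinth.theorem4p3_general hQ.left_turn hW.subset_cells hW.tree.connected.preconnected
    hW.exit_left_right.exists hW.exit_top_bottom.exists hW.corner₁₃ hW.corner₂₄
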